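/- Let $K$ be a field of characteristic $0$. For a finite-dimensional nilpotent Lie algebra $\mathfrak g$ over $K$, the breadth of $\mathfrak g$ is $\max\{\operatorname{rank}(\operatorname{ad}X) : X\in\mathfrak g\}$, and the characteristic sequence of $\mathfrak g$ is the maximum, for the lexicographic order, over all $X\in\mathfrak g\setminus[\mathfrak g,\mathfrak g]$, of the nonincreasing sequence of the dimensions of the Jordan blocks of the nilpotent operator $\operatorname{ad}X$. Every $n$-dimensional nilpotent Lie algebra over $K$ ($n\ge 5$) of breadth $3$ and characteristic sequence $(4,1,\dots,1)$ is isomorphic to a Lie algebra on $K^n$ with canonical basis $X_1,\dots,X_n$ belonging to one of the following two families, where the parameters $a,a_k,b_k,d_k,c_{i,j}$ are elements of $K$ and the brackets $[X_i,X_j]$, $i<j$, that are not listed are zero: (1) $[X_1,X_i]=X_{i+1}$ for $i=2,3,4$; $[X_2,X_3]=aX_5$; $[X_2,X_k]=a_kX_4+b_kX_5$ and $[X_3,X_k]=a_kX_5$ for $6\le k\le n$; $[X_i,X_j]=c_{i,j}X_5$ for $6\le i<j\le n$; (2) $[X_1,X_i]=X_{i+1}$ for $i=2,3,4$; $[X_2,X_3]=aX_5+\sum_{k=6}^n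 d_kX_k$; $[X_2,X_k]=b_kX_5$ for $6\le k\le n$; $[X_i,X_j]=c_{i,j}X_5$ for $6\le i<j\le n$; with $$\sum_{i=6}^{j-1}c_{i,j}d_i-\sum_{i=j+1}^{n}c_{j,i}d_i=0\qquad\text{for } 6\le j\le n.$$ -/

import Mathlib

namespace NilpotentLie

/-- The breadth of a (finite-dimensional) Lie algebra: the maximal rank of the operators `ad x`. -/
noncomputable def breadth (K L : Type*) [Field K] [LieRing L] [LieAlgebra K L] : ℕ :=
  sSup (Set.range fun x : L => Module.finrank K (LinearMap.range (LieAlgebra.ad K L x)))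

/-- `c` is the nonincreasing sequence of the dimensions of the Jordan blocks (for the eigenvalue
`0`) of the nilpotent endomorphism `f`: some basis, indexed by the pairs of a block and a position
in that block, is shifted by `f` inside every block, the last vector of a block going to `0`. -/
def HasJordanBlockSizes {K V : Type*} [Field K] [AddCommGroup V] [Module K V]
    (f : Module.End K V) (c : List ℕ) : Prop :=
  c.Pairwise (fun p q => q ≤ p) ∧ (∀ m ∈ c, 0 < m) ∧
    ∃ b : Module.Basis (Σ i : Fin c.length, Fin (c.get i)) K V,
      ∀ (i : Fin c.length) (j : Fin (c.get i)),
        f (b ⟨i, j⟩) = if h : (j : ℕ) + 1 < c.get i then b ⟨i, ⟨(j : ℕ) + 1, h⟩⟩ else 0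

/-- `c` is the characteristic sequence of `L`: the maximum, for the lexicographic order, of the
sequences of Jordan block sizes of the operators `ad x`, where `x` runs over the elements of `L`
outside the derived subalgebra. -/
def IsCharacteristicSequence (K L : Type*) [Field K] [LieRing L] [LieAlgebra K L]
    (c : List ℕ) : Prop :=
  IsGreatest {d : List ℕ | ∃ x : L, x ∉ LieAlgebra.derivedSeries K L 1 ∧
    HasJordanBlockSizes (LieAlgebra.ad K L x) d} c

section Families

variable {K : Type*} [Field K] {n : ℕ}

/-- The vector `X_k` of the canonical basis `X_1, …, X_n` of `K ^ n`, numbered from `1`. -/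
def X (k : ℕ) : Fin n → K := fun i => if (i : ℕ) + 1 = k then 1 else 0

/-- `μ` is a Lie bracket on `K ^ n`: an alternating bilinear map with the Jacobi identity. -/
def IsLieBracket (μ : (Fin n → K) →ₗ[K] (Fin n → K) →ₗ[K] (Fin n → K)) : Prop :=
  (∀ x, μ x x = 0) ∧ ∀ x y z, μ (μ x y) z + μ (μ y z) x + μ (μ z x) y = 0

/-- The value of `[X_i, X_j]`, for `1 ≤ i < j ≤ n`, in the first family. -/
def firstBracket (a : K) (α β : ℕ → K) (c : ℕ → ℕ → K) (i j : ℕ) : Fin n → K :=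
  if i = 1 ∧ j ∈ ({2, 3, 4} : Finset ℕ) then X (j + 1)
  else if i = 2 ∧ j = 3 then a • X 5
  else if i = 2 ∧ 6 ≤ j then α j • X 4 + β j • X 5
  else if i = 3 ∧ 6 ≤ j then α j • X 5
  else if 6 ≤ i then c i j • X 5
  else 0

/-- The value of `[X_i, X_j]`, for `1 ≤ i < j ≤ n`, in the second family. -/
def secondBracket (a : K) (β d : ℕ → K) (c : ℕ → ℕ → K) (i j : ℕ) : Fin n → K :=
  if i = 1 ∧ j ∈ ({2, 3, 4} : Finset ℕ) then X (j + 1)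
  else if i = 2 ∧ j = 3 then a • X 5 + ∑ k ∈ Finset.Icc 6 n, d k • X k
  else if i = 2 ∧ 6 ≤ j then β j • X 5
  else if 6 ≤ i then c i j • X 5
  else 0

/-- The Lie algebra `(K ^ n, μ)` belongs to the first family. -/
def InFirstFamily (μ : (Fin n → K) →ₗ[K] (Fin n → K) →ₗ[K] (Fin n → K)) : Prop :=
  IsLieBracket μ ∧ ∃ (a : K) (α β : ℕ → K) (c : ℕ → ℕ → K),
    ∀ i j : ℕ, 1 ≤ i → i < j → j ≤ n → μ (X i) (X j) = firstBracket a α β c i j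

/-- The Lie algebra `(K ^ n, μ)` belongs to the second family. -/
def InSecondFamily (μ : (Fin n → K) →ₗ[K] (Fin n → K) →ₗ[K] (Fin n → K)) : Prop :=
  IsLieBracket μ ∧ ∃ (a : K) (β d : ℕ → K) (c : ℕ → ℕ → K),
    (∀ j : ℕ, 6 ≤ j → j ≤ n →
      ∑ i ∈ Finset.Ico 6 j, c i j * d i - ∑ i ∈ Finset.Ioc j n, c j i * d i = 0) ∧
    ∀ i j : ℕ, 1 ≤ i → i < j → j ≤ n → μ (X i) (X j) = secondBracket a β d c i j

end Families

end NilpotentLie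

/-! Take `x₁` whose `ad x₁` has a Jordan block of size 4, with chain `x₂`, `x₃`, `x₄`, `x₅`. Breadth
3 forces the image of `ad x₁` to be the span of `x₃`, `x₄`, `x₅`. As `ad x₁` has maximal rank in
each pencil `s • ad x₁ + ad y`, every `ad y` maps its kernel into that image
(`apply_mem_range_of_finrank_range_le`, over an infinite field). Jacobi then leaves few free
coefficients, and nilpotency kills those that would be nonzero eigenvalues. After replacing `x₂` by
some `x₂ - r • x₁`, the bracket `⁅x₂, x₃⁆` commutes with `x₁` and lies in `compl`, a complement of
`x₁` in the kernel. Brackets inside `compl` are multiples of `x₅`. The families separate according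
to whether `⁅x₂, x₃⁆` is a multiple of `x₅`. If not, the rank bound for `ad (x₁ + x₂)` removes the
`x₄`-part of `⁅x₂, v⁆` for `v` in `compl` (`exists_lie_eq_smul`), and Jacobi gives the linear
relations of the second family. -/

namespace NilpotentLie

/-! ### Rank of a pencil, eigenvalues and Jordan chains -/

section LinearAlgebra

variable {K V : Type*} [Field K] [AddCommGroup V] [Module K V]

/-- If the rank does not grow along the pencil `s • A + B`, then `B` maps the kernel of `A` into
the range of `A`. -/
theorem apply_mem_range_of_finrank_range_le [Infinite K] [FiniteDimensional K V]
    {A B : Module.End K V}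
    (h : ∀ s : K, Module.finrank K (LinearMap.range (s • A + B)) ≤
      Module.finrank K (LinearMap.range A))
    {v : V} (hv : A v = 0) : B v ∈ LinearMap.range A := by
  by_contra hB
  obtain ⟨U, hU⟩ := Submodule.exists_isCompl (LinearMap.ker A)
  have hUr : Module.finrank K U = Module.finrank K (LinearMap.range A) := by
    have h1 := Submodule.finrank_add_eq_of_isCompl hU
    have h2 := LinearMap.finrank_range_add_finrank_ker A
    omega
  have hker : ∀ u : U, A u = 0 → u = 0 := by
    intro u hu
    have : (u : V) ∈ LinearMap.ker A ⊓ U := ⟨hu, u.2⟩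
    rw [hU.inf_eq_bot] at this
    exact Subtype.ext this
  let C : (U × K) →ₗ[K] V :=
    (A ∘ₗ U.subtype).coprod (LinearMap.toSpanSingleton K V (B v))
  have hC : ∀ p : U × K, C p = A p.1 + p.2 • B v := fun p => by simp [C]
  have hCinj : LinearMap.ker C = ⊥ := by
    rw [LinearMap.ker_eq_bot']
    rintro ⟨u, c⟩ hp
    rw [hC] at hp
    simp only at hp
    have hc : c = 0 := by
      by_contra hc
      apply hB
      refine ⟨-(c⁻¹ • (u : V)), ?_⟩
      rw [map_neg, map_smul, eq_neg_of_add_eq_zero_left hp, smul_neg, neg_neg, smul_smul,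
        inv_mul_cancel₀ hc, one_smul]
    subst hc
    rw [zero_smul, add_zero] at hp
    rw [hker u hp]
    rfl
  obtain ⟨G, hG⟩ := LinearMap.exists_leftInverse_of_injective C hCinj
  let N : Module.End K (U × K) := G ∘ₗ B ∘ₗ U.subtype ∘ₗ LinearMap.fst K U K
  obtain ⟨s, hs⟩ := N.finite_hasEigenvalue.exists_notMem
  -- The factor `-s` on `v` makes `E = -s • C + B` on the `U`-part. Applying `G`, a kernel vector of
  -- `E` would be an eigenvector of `N` for `s`, so `E` is injective and the rank exceeds that of
  -- `A`.
  let E : (U × K) →ₗ[K] V := ((-s) • A + B) ∘ₗ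
    (U.subtype.coprod (LinearMap.toSpanSingleton K V ((-s) • v)))
  have hE : ∀ p, E p = (-s) • C p + B p.1 := by
    intro p
    simp only [E, LinearMap.comp_apply, LinearMap.coprod_apply, Submodule.subtype_apply,
      LinearMap.toSpanSingleton_apply, LinearMap.add_apply, LinearMap.smul_apply, map_add,
      map_smul, hC, hv, smul_zero, zero_add]
    module
  have hEinj : Function.Injective E := by
    rw [← LinearMap.ker_eq_bot, LinearMap.ker_eq_bot']
    intro p hp
    by_contra hp0
    refine hs (Module.End.hasEigenvalue_of_hasEigenvector (x := p)
      ⟨Module.End.mem_eigenspace_iff.2 ?_, hp0⟩)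
    have h1 := congrArg G hp
    rw [hE, map_add, map_smul, map_zero] at h1
    have h2 : G (C p) = p := LinearMap.congr_fun hG p
    rw [h2, neg_smul, neg_add_eq_zero] at h1
    exact h1.symm
  have h1 : Module.finrank K (U × K) ≤ Module.finrank K (LinearMap.range ((-s) • A + B)) := by
    rw [← LinearMap.finrank_range_of_inj hEinj]
    exact Submodule.finrank_mono (LinearMap.range_comp_le_range _ _)
  have h2 := h (-s)
  rw [Module.finrank_prod, Module.finrank_self] at h1
  omega

theorem eq_zero_of_isNilpotent_of_apply_eq_smul {f : Module.End K V} (hf : IsNilpotent f)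
    {c : K} {v : V} (h : f v = c • v) (hv : v ≠ 0) : c = 0 := by
  obtain ⟨k, hk⟩ := hf
  have : ∀ m : ℕ, (f ^ m) v = c ^ m • v := by
    intro m
    induction m with
    | zero => simp
    | succ m ih => rw [pow_succ', Module.End.mul_apply, ih, map_smul, h, smul_smul, pow_succ]
  have h1 := this k
  rw [hk, LinearMap.zero_apply] at h1
  exact eq_zero_of_pow_eq_zero ((smul_eq_zero.1 h1.symm).resolve_right hv)

theorem exists_chain_of_hasJordanBlockSizes {f : Module.End K V} {c : List ℕ} {m : ℕ}
    (h : HasJordanBlockSizes f ((m + 1) :: c)) :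
    ∃ x : V, (f ^ m) x ≠ 0 ∧ (f ^ (m + 1)) x = 0 := by
  obtain ⟨-, -, b, hb⟩ := h
  let i : Fin ((m + 1) :: c).length := ⟨0, by simp⟩
  have key : ∀ k (hk : k < m + 1), (f ^ k) (b ⟨i, ⟨0, Nat.succ_pos m⟩⟩) = b ⟨i, ⟨k, hk⟩⟩ := by
    intro k
    induction k with
    | zero => intro _; rfl
    | succ k ih =>
      intro hk
      rw [pow_succ', Module.End.mul_apply, ih (by omega), hb]
      exact dif_pos hk
  refine ⟨b ⟨i, ⟨0, Nat.succ_pos m⟩⟩, ?_, ?_⟩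
  · rw [key m (by omega)]
    exact b.ne_zero _
  · rw [pow_succ', Module.End.mul_apply, key m (by omega), hb, dif_neg]
    simp [i]

theorem coeff_eq_zero_of_apply_eq {f : Module.End K V} {x y z : V} (hx : f x = y) (hy : f y = z)
    (hz : f z = 0) (hz0 : z ≠ 0) {p q r : K} (h : p • x + q • y + r • z = 0) :
    p = 0 ∧ q = 0 ∧ r = 0 := by
  have h1 := congrArg f h
  simp only [map_add, map_smul, hx, hy, hz, smul_zero, add_zero, map_zero] at h1
  have h2 := congrArg f h1
  simp only [map_add, map_smul, hy, hz, smul_zero, add_zero, map_zero] at h2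
  have hp : p = 0 := (smul_eq_zero.1 h2).resolve_right hz0
  subst hp
  rw [zero_smul, zero_add] at h1
  have hq : q = 0 := (smul_eq_zero.1 h1).resolve_right hz0
  subst hq
  rw [zero_smul, zero_smul, zero_add, zero_add] at h
  exact ⟨rfl, rfl, (smul_eq_zero.1 h).resolve_right hz0⟩

end LinearAlgebra

theorem finrank_range_ad_le_breadth (K : Type*) {L : Type*} [Field K] [LieRing L] [LieAlgebra K L]
    [FiniteDimensional K L] (x : L) :
    Module.finrank K (LinearMap.range (LieAlgebra.ad K L x)) ≤ breadth K L := by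
  refine le_csSup ⟨Module.finrank K L, ?_⟩ ⟨x, rfl⟩
  rintro _ ⟨y, rfl⟩
  exact Submodule.finrank_le _

/-! ### Chains in a nilpotent Lie algebra -/

section Lie

variable {K L : Type*} [Field K] [LieRing L] [LieAlgebra K L]

theorem eq_zero_of_lie_eq_smul [LieRing.IsNilpotent L] {c : K} {y v : L} (hv : v ≠ 0)
    (h : ⁅y, v⁆ = c • v) : c = 0 :=
  eq_zero_of_isNilpotent_of_apply_eq_smul
    (LieModule.isNilpotent_toEnd_of_isNilpotent K L L y) h hv

/-- `x₅` is the last vector of a Jordan block of size `4` of `ad x₁`, the image of which is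
spanned by `x₃`, `x₄`, `x₅`; moreover every `ad y` maps the kernel of `ad x₁` into this image. -/
structure IsChain (K : Type*) {L : Type*} [Field K] [LieRing L] [LieAlgebra K L]
    (x₁ x₂ x₃ x₄ x₅ : L) : Prop where
  lie₂ : ⁅x₁, x₂⁆ = x₃
  lie₃ : ⁅x₁, x₃⁆ = x₄
  lie₄ : ⁅x₁, x₄⁆ = x₅
  lie₅ : ⁅x₁, x₅⁆ = 0
  ne_zero : x₅ ≠ 0
  exists_lie : ∀ y : L, ∃ p q r : K, ⁅x₁, y⁆ = p • x₃ + q • x₄ + r • x₅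
  exists_lie_of_lie_eq_zero : ∀ y v : L, ⁅x₁, v⁆ = 0 →
    ∃ p q r : K, ⁅y, v⁆ = p • x₃ + q • x₄ + r • x₅

namespace IsChain

variable {x₁ x₂ x₃ x₄ x₅ : L} (h : IsChain K x₁ x₂ x₃ x₄ x₅)
include h

theorem lie_comb (p q r s : K) :
    ⁅x₁, p • x₂ + q • x₃ + r • x₄ + s • x₅⁆ = p • x₃ + q • x₄ + r • x₅ := by
  simp only [lie_add, lie_smul, h.lie₂, h.lie₃, h.lie₄, h.lie₅, smul_zero, add_zero]

theorem lie_comb' (p q r : K) : ⁅x₁, p • x₃ + q • x₄ + r • x₅⁆ = p • x₄ + q • x₅ := by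
  simp only [lie_add, lie_smul, h.lie₃, h.lie₄, h.lie₅, smul_zero, add_zero]

theorem coeff_eq_zero {p q r : K} (hz : p • x₃ + q • x₄ + r • x₅ = 0) :
    p = 0 ∧ q = 0 ∧ r = 0 :=
  coeff_eq_zero_of_apply_eq (f := LieAlgebra.ad K L x₁) h.lie₃ h.lie₄ h.lie₅ h.ne_zero hz

/-- The action of the vectors of the chain on a vector `v` of the kernel of `ad x₁` is determined
by the value of `⁅x₂, v⁆`. -/
theorem lie_of_lie₂ {v : L} (hv : ⁅x₁, v⁆ = 0) {p q r : K}
    (h2 : ⁅x₂, v⁆ = p • x₃ + q • x₄ + r • x₅) :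
    ⁅x₃, v⁆ = p • x₄ + q • x₅ ∧ ⁅x₄, v⁆ = p • x₅ ∧ ⁅x₅, v⁆ = 0 := by
  have h3 : ⁅x₃, v⁆ = p • x₄ + q • x₅ := by
    rw [← h.lie₂, lie_lie, h2, hv, lie_zero, sub_zero, h.lie_comb']
  have h4 : ⁅x₄, v⁆ = p • x₅ := by
    rw [← h.lie₃, lie_lie, h3, hv, lie_zero, sub_zero, lie_add, lie_smul, lie_smul, h.lie₄,
      h.lie₅, smul_zero, add_zero]
  refine ⟨h3, h4, ?_⟩
  rw [← h.lie₄, lie_lie, h4, hv, lie_zero, sub_zero, lie_smul, h.lie₅, smul_zero]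

/-- The coefficients of `⁅x₂, x₅⁆` become, one after the other, eigenvalues of `ad x₄`, `ad x₃`, `ad
x₂` on `x₅`, hence vanish. -/
theorem lie_x₅ [LieRing.IsNilpotent L] : ⁅x₂, x₅⁆ = 0 ∧ ⁅x₃, x₅⁆ = 0 ∧ ⁅x₄, x₅⁆ = 0 := by
  obtain ⟨p, q, r, h2⟩ := h.exists_lie_of_lie_eq_zero x₂ x₅ h.lie₅
  obtain ⟨h3, h4, -⟩ := h.lie_of_lie₂ h.lie₅ h2
  have hp := eq_zero_of_lie_eq_smul h.ne_zero h4
  subst hp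
  rw [zero_smul, zero_add] at h2 h3
  have hq := eq_zero_of_lie_eq_smul h.ne_zero h3
  subst hq
  rw [zero_smul, zero_add] at h2
  have hr := eq_zero_of_lie_eq_smul h.ne_zero h2
  subst hr
  simp only [zero_smul] at h2 h3 h4
  exact ⟨h2, h3, h4⟩

/-- Changing `x₂` by a multiple of `x₁`, one may assume that `⁅x₂, x₃⁆` commutes with `x₁`. -/
theorem exists_lie_lie_eq_zero [LieRing.IsNilpotent L] :
    ∃ x₂' : L, IsChain K x₁ x₂' x₃ x₄ x₅ ∧ ⁅x₁, ⁅x₂', x₃⁆⁆ = 0 := by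
  obtain ⟨h25, h35, h45⟩ := h.lie_x₅
  obtain ⟨p, q, r, hz⟩ := h.exists_lie ⁅x₂, x₃⁆
  have h24 : ⁅x₂, x₄⁆ = p • x₃ + q • x₄ + r • x₅ := by
    rw [← hz, leibniz_lie, h.lie₂, lie_self, zero_add, h.lie₃]
  have h34 : ⁅x₃, x₄⁆ = p • x₄ + q • x₅ := by
    rw [← h.lie_comb' p q r, ← h24, leibniz_lie, h.lie₂, h.lie₄, h25, add_zero]
  -- Two evaluations of `⁅x₁, ⁅x₃, x₄⁆⁆`: `p • x₅` and `⁅x₃, x₅⁆ = 0`.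
  have hp : p = 0 := by
    have : ⁅x₁, ⁅x₃, x₄⁆⁆ = 0 := by
      rw [leibniz_lie, h.lie₃, lie_self, zero_add, h.lie₄, h35]
    rw [h34, lie_add, lie_smul, lie_smul, h.lie₄, h.lie₅, smul_zero, add_zero] at this
    exact (smul_eq_zero.1 this).resolve_right h.ne_zero
  subst hp
  rw [zero_smul, zero_add] at h24
  -- Otherwise `q • x₄ + r • x₅` is an eigenvector of `ad x₂` with eigenvalue `q`.
  have hq : q = 0 := by
    by_contra hq
    refine hq (eq_zero_of_lie_eq_smul (y := x₂) (v := q • x₄ + r • x₅) ?_ ?_)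
    · intro h0
      refine hq (h.coeff_eq_zero (p := 0) (q := q) (r := r) ?_).2.1
      rw [zero_smul, zero_add, h0]
    · rw [lie_add, lie_smul, lie_smul, h25, smul_zero, add_zero, h24]
  subst hq
  rw [zero_smul, zero_smul, zero_add, zero_add] at hz
  refine ⟨x₂ - r • x₁, ⟨?_, h.lie₃, h.lie₄, h.lie₅, h.ne_zero, h.exists_lie,
    h.exists_lie_of_lie_eq_zero⟩, ?_⟩
  · rw [lie_sub, lie_smul, lie_self, smul_zero, sub_zero, h.lie₂]
  · rw [sub_lie, smul_lie, h.lie₃, lie_sub, lie_smul, hz, h.lie₄, sub_self]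

theorem lie_x₄ [LieRing.IsNilpotent L] (h23 : ⁅x₁, ⁅x₂, x₃⁆⁆ = 0) :
    ⁅x₂, x₄⁆ = 0 ∧ ⁅x₃, x₄⁆ = 0 := by
  have h24 : ⁅x₂, x₄⁆ = 0 := by
    rw [← h23, leibniz_lie, h.lie₂, lie_self, zero_add, h.lie₃]
  refine ⟨h24, ?_⟩
  have := congrArg (fun v => ⁅x₁, v⁆) h24
  simpa only [leibniz_lie, h.lie₂, h.lie₄, h.lie_x₅.1, add_zero, lie_zero] using this

/-- A chosen complement of `x₁` in the kernel of `ad x₁`. -/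
def compl (_ : IsChain K x₁ x₂ x₃ x₄ x₅) : Submodule K L where
  carrier := {v | ⁅x₁, v⁆ = 0 ∧ ∃ q r : K, ⁅x₂, v⁆ = q • x₄ + r • x₅}
  add_mem' := by
    rintro v w ⟨hv, q, r, hv'⟩ ⟨hw, s, t, hw'⟩
    refine ⟨by rw [lie_add, hv, hw, add_zero], q + s, r + t, ?_⟩
    rw [lie_add, hv', hw']
    module
  zero_mem' := ⟨lie_zero _, 0, 0, by simp⟩
  smul_mem' := by
    rintro c v ⟨hv, q, r, hv'⟩
    refine ⟨by rw [lie_smul, hv, smul_zero], c * q, c * r, ?_⟩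
    rw [lie_smul, hv']
    module

theorem x₅_mem_compl [LieRing.IsNilpotent L] : x₅ ∈ h.compl :=
  ⟨h.lie₅, 0, 0, by rw [h.lie_x₅.1]; simp⟩

theorem lie_mem_compl [LieRing.IsNilpotent L] (h23 : ⁅x₁, ⁅x₂, x₃⁆⁆ = 0) :
    ⁅x₂, x₃⁆ ∈ h.compl := by
  obtain ⟨p, q, r, hz⟩ := h.exists_lie_of_lie_eq_zero x₂ _ h23
  suffices hp : p = 0 by
    subst hp
    exact ⟨h23, q, r, by rw [hz, zero_smul, zero_add]⟩
  by_contra hp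
  -- Since `ad x₂` kills `x₄` and `x₅`, its square sends `⁅x₂, ⁅x₂, x₃⁆⁆` to `p` times itself.
  let f := LieAlgebra.ad K L x₂
  have hf : IsNilpotent (f ^ 2) :=
    (LieModule.isNilpotent_toEnd_of_isNilpotent K L L x₂).pow_of_pos two_ne_zero
  refine hp (eq_zero_of_isNilpotent_of_apply_eq_smul hf (v := p • x₃ + q • x₄ + r • x₅) ?_ ?_)
  · simp only [pow_two, Module.End.mul_apply, f, LieAlgebra.ad_apply, lie_add, lie_smul, hz,
      (h.lie_x₄ h23).1, h.lie_x₅.1, smul_zero, add_zero]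
  · exact fun h0 => hp (h.coeff_eq_zero h0).1

/-- The brackets of the chain with the chosen complement. -/
theorem exists_lie_compl {v : L} (hv : v ∈ h.compl) : ∃ q r : K,
    ⁅x₂, v⁆ = q • x₄ + r • x₅ ∧ ⁅x₃, v⁆ = q • x₅ ∧ ⁅x₄, v⁆ = 0 ∧ ⁅x₅, v⁆ = 0 := by
  obtain ⟨h1, q, r, h2⟩ := hv
  have := h.lie_of_lie₂ h1 (p := 0) (q := q) (r := r) (by rw [h2, zero_smul, zero_add])
  simp only [zero_smul, zero_add] at this
  exact ⟨q, r, h2, this⟩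

theorem exists_lie_compl_compl {v w : L} (hv : v ∈ h.compl) (hw : w ∈ h.compl) :
    ∃ c : K, ⁅v, w⁆ = c • x₅ := by
  obtain ⟨p, q, r, hz⟩ := h.exists_lie_of_lie_eq_zero v w hw.1
  have h0 : ⁅x₁, ⁅v, w⁆⁆ = 0 := by
    rw [leibniz_lie, hv.1, hw.1, zero_lie, lie_zero, add_zero]
  rw [hz, h.lie_comb'] at h0
  obtain ⟨-, hp, hq⟩ := h.coeff_eq_zero (p := 0) (q := p) (r := q) (by rw [← h0]; module)
  subst hp hq
  exact ⟨r, by rw [hz]; module⟩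

/-- Subtracting a combination of the chain moves `y` into the kernel of `ad x₁`; because `⁅x₂, x₁⁆ =
-x₃`, a multiple of `x₁` then corrects it into `compl`. -/
theorem exists_eq_add (y : L) : ∃ (c₁ c₂ c₃ c₄ : K) (m : L), m ∈ h.compl ∧
    y = c₁ • x₁ + c₂ • x₂ + c₃ • x₃ + c₄ • x₄ + m := by
  obtain ⟨c₂, c₃, c₄, hy⟩ := h.exists_lie y
  have h1 : ⁅x₁, y - (c₂ • x₂ + c₃ • x₃ + c₄ • x₄ + (0 : K) • x₅)⁆ = 0 := by
    rw [lie_sub, h.lie_comb, hy, sub_self]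
  obtain ⟨p, q, r, h2⟩ := h.exists_lie_of_lie_eq_zero x₂ _ h1
  refine ⟨-p, c₂, c₃, c₄, y - (c₂ • x₂ + c₃ • x₃ + c₄ • x₄ + (0 : K) • x₅) + p • x₁,
    ⟨?_, q, r, ?_⟩, by module⟩
  · rw [lie_add, h1, lie_smul, lie_self, smul_zero, add_zero]
  · rw [lie_add, h2, lie_smul, ← lie_skew, h.lie₂]
    module

theorem eq_zero_of_add_eq_zero {c₁ c₂ c₃ c₄ : K} {m : L} (hm : m ∈ h.compl)
    (hz : c₁ • x₁ + c₂ • x₂ + c₃ • x₃ + c₄ • x₄ + m = 0) :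
    c₁ = 0 ∧ c₂ = 0 ∧ c₃ = 0 ∧ c₄ = 0 ∧ m = 0 := by
  have h1 := congrArg (fun v => ⁅x₁, v⁆) hz
  simp only [lie_add, lie_smul, lie_self, h.lie₂, h.lie₃, h.lie₄, hm.1, smul_zero, lie_zero,
    zero_add, add_zero] at h1
  obtain ⟨rfl, rfl, rfl⟩ := h.coeff_eq_zero h1
  simp only [zero_smul, add_zero] at hz
  obtain ⟨-, q, r, h2⟩ := hm
  have h3 := congrArg (fun v => ⁅x₂, v⁆) hz
  simp only [lie_add, lie_smul, h2, lie_zero] at h3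
  rw [← lie_skew, h.lie₂] at h3
  obtain ⟨h4, -, -⟩ := h.coeff_eq_zero (p := -c₁) (q := q) (r := r) (by rw [← h3]; module)
  rw [neg_eq_zero] at h4
  subst h4
  rw [zero_smul, zero_add] at hz
  exact ⟨rfl, rfl, rfl, rfl, hz⟩

end IsChain

/-- Three independent vectors exhaust an image of dimension at most 3; the pencil lemma applies
because `s • ad x + ad y` is again some `ad`. -/
theorem exists_isChain [Infinite K] [FiniteDimensional K L]
    (hr : ∀ y : L, Module.finrank K (LinearMap.range (LieAlgebra.ad K L y)) ≤ 3)
    {x : L} {c : List ℕ} (hx : HasJordanBlockSizes (LieAlgebra.ad K L x) (4 :: c)) :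
    ∃ x₂ x₃ x₄ x₅ : L, IsChain K x x₂ x₃ x₄ x₅ := by
  obtain ⟨x₂, h5, h6⟩ := exists_chain_of_hasJordanBlockSizes (m := 3) hx
  simp only [pow_succ', pow_zero, mul_one, Module.End.mul_apply, LieAlgebra.ad_apply] at h5 h6
  have hli : LinearIndependent K ![⁅x, x₂⁆, ⁅x, ⁅x, x₂⁆⁆, ⁅x, ⁅x, ⁅x, x₂⁆⁆⁆] := by
    rw [Fintype.linearIndependent_iff]
    intro g hg
    rw [Fin.sum_univ_three] at hg
    obtain ⟨h0, h1, h2⟩ :=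
      coeff_eq_zero_of_apply_eq (f := LieAlgebra.ad K L x) rfl rfl h6 h5 hg
    intro i
    fin_cases i
    exacts [h0, h1, h2]
  have hle : Submodule.span K (Set.range ![⁅x, x₂⁆, ⁅x, ⁅x, x₂⁆⁆, ⁅x, ⁅x, ⁅x, x₂⁆⁆⁆]) ≤
      LinearMap.range (LieAlgebra.ad K L x) := by
    rw [Submodule.span_le]
    rintro _ ⟨i, rfl⟩
    fin_cases i
    exacts [⟨_, rfl⟩, ⟨_, rfl⟩, ⟨_, rfl⟩]
  have hcard := finrank_span_eq_card hli
  rw [Fintype.card_fin] at hcard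
  have heq := Submodule.eq_of_le_of_finrank_le hle (by rw [hcard]; exact hr x)
  have hmem : ∀ y ∈ LinearMap.range (LieAlgebra.ad K L x), ∃ p q r : K,
      y = p • ⁅x, x₂⁆ + q • ⁅x, ⁅x, x₂⁆⁆ + r • ⁅x, ⁅x, ⁅x, x₂⁆⁆⁆ := by
    intro y hy
    rw [← heq, Submodule.mem_span_range_iff_exists_fun] at hy
    obtain ⟨g, rfl⟩ := hy
    exact ⟨g 0, g 1, g 2, Fin.sum_univ_three _⟩
  refine ⟨x₂, _, _, _, rfl, rfl, rfl, h6, h5, fun y => hmem _ ⟨y, rfl⟩, fun y v hv => hmem _ ?_⟩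
  refine apply_mem_range_of_finrank_range_le (B := LieAlgebra.ad K L y) (fun s => ?_) hv
  rw [← heq, hcard, ← map_smul, ← map_add]
  exact hr _

namespace IsChain

variable {x₁ x₂ x₃ x₄ x₅ : L} (h : IsChain K x₁ x₂ x₃ x₄ x₅)
include h

/-- A nonzero `x₄`-coefficient in `⁅x₂, v⁆` would put the four independent vectors `x₃`, `x₄`, `x₅`,
`⁅x₂, x₃⁆` into the image of `ad (x₁ + x₂)`. -/
theorem exists_lie_eq_smul [LieRing.IsNilpotent L] [FiniteDimensional K L]
    (hr : Module.finrank K (LinearMap.range (LieAlgebra.ad K L (x₁ + x₂))) ≤ 3)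
    (h23 : ⁅x₁, ⁅x₂, x₃⁆⁆ = 0) (hz : ∀ a : K, ⁅x₂, x₃⁆ ≠ a • x₅) {v : L} (hv : v ∈ h.compl) :
    ∃ r : K, ⁅x₂, v⁆ = r • x₅ ∧ ⁅x₃, v⁆ = 0 := by
  obtain ⟨q, r, hv2, hv3, -⟩ := h.exists_lie_compl hv
  suffices hq : q = 0 by
    subst hq
    exact ⟨r, by rw [hv2, zero_smul, zero_add], by rw [hv3, zero_smul]⟩
  by_contra hq
  have hli : LinearIndependent K ![x₃, x₄, x₅, ⁅x₂, x₃⁆] := by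
    rw [Fintype.linearIndependent_iff]
    intro g hg
    rw [Fin.sum_univ_four] at hg
    change g 0 • x₃ + g 1 • x₄ + g 2 • x₅ + g 3 • ⁅x₂, x₃⁆ = 0 at hg
    obtain ⟨-, -, h0, h1, hm⟩ := h.eq_zero_of_add_eq_zero (c₁ := 0) (c₂ := 0) (c₃ := g 0)
      (c₄ := g 1) (h.compl.add_mem (h.compl.smul_mem (g 2) h.x₅_mem_compl)
        (h.compl.smul_mem (g 3) (h.lie_mem_compl h23))) (by rw [← hg]; module)
    have h3 : g 3 = 0 := by
      by_contra h3
      refine hz (-((g 3)⁻¹ * g 2)) ?_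
      have := congrArg (fun v => (g 3)⁻¹ • v) hm
      simp only [smul_add, smul_smul, inv_mul_cancel₀ h3, one_smul, smul_zero] at this
      rw [neg_smul, eq_neg_of_add_eq_zero_right this]
    rw [h3, zero_smul, add_zero] at hm
    have h2 := (smul_eq_zero.1 hm).resolve_right h.ne_zero
    intro i
    fin_cases i
    exacts [h0, h1, h2, h3]
  have m3 : x₃ ∈ LinearMap.range (LieAlgebra.ad K L (x₁ + x₂)) :=
    ⟨x₂, by rw [LieAlgebra.ad_apply, add_lie, lie_self, add_zero, h.lie₂]⟩
  have m5 : x₅ ∈ LinearMap.range (LieAlgebra.ad K L (x₁ + x₂)) :=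
    ⟨x₄, by rw [LieAlgebra.ad_apply, add_lie, (h.lie_x₄ h23).1, add_zero, h.lie₄]⟩
  have m4 : x₄ ∈ LinearMap.range (LieAlgebra.ad K L (x₁ + x₂)) := by
    have h1 : q • x₄ + r • x₅ ∈ LinearMap.range (LieAlgebra.ad K L (x₁ + x₂)) :=
      ⟨v, by rw [LieAlgebra.ad_apply, add_lie, hv.1, zero_add, hv2]⟩
    rw [Submodule.add_mem_iff_left _ (Submodule.smul_mem _ _ m5)] at h1
    exact (Submodule.smul_mem_iff _ hq).1 h1
  have mz : ⁅x₂, x₃⁆ ∈ LinearMap.range (LieAlgebra.ad K L (x₁ + x₂)) := by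
    rw [← Submodule.add_mem_iff_right _ m4]
    exact ⟨x₃, by rw [LieAlgebra.ad_apply, add_lie, h.lie₃]⟩
  have hle : Submodule.span K (Set.range ![x₃, x₄, x₅, ⁅x₂, x₃⁆]) ≤
      LinearMap.range (LieAlgebra.ad K L (x₁ + x₂)) := by
    rw [Submodule.span_le]
    rintro _ ⟨i, rfl⟩
    fin_cases i
    exacts [m3, m4, m5, mz]
  have h4 := Submodule.finrank_mono hle
  rw [finrank_span_eq_card hli, Fintype.card_fin] at h4
  omega

/-- A basis adapted to the chain, as a sequence numbered from `1`. -/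
theorem exists_basis [LieRing.IsNilpotent L] [FiniteDimensional K L] {n : ℕ}
    (hn : Module.finrank K L = n) :
    ∃ (v : ℕ → L) (b : Module.Basis (Fin n) K L), (∀ i, b i = v (i + 1)) ∧
      v 1 = x₁ ∧ v 2 = x₂ ∧ v 3 = x₃ ∧ v 4 = x₄ ∧ v 5 = x₅ ∧ (∀ k, 6 ≤ k → v k ∈ h.compl) ∧
      ∀ y ∈ h.compl, ∃ (a : K) (d : ℕ → K), y = a • x₅ + ∑ k ∈ Finset.Icc 6 n, d k • v k := by
  let x : h.compl := ⟨x₅, h.x₅_mem_compl⟩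
  have hx0 : x ≠ 0 := fun hx => h.ne_zero (congrArg Subtype.val hx)
  obtain ⟨Q, hQ⟩ := Submodule.exists_isCompl (Submodule.span K {x})
  let m := Module.finrank K Q
  let B : Module.Basis (Fin (m + 1)) K h.compl := Module.Basis.mkFinCons x (Module.finBasis K Q)
    (by
      intro c y hy hcy
      have : c • x ∈ Submodule.span K {x} ⊓ Q :=
        ⟨Submodule.smul_mem _ _ (Submodule.mem_span_singleton_self x), by
          rw [eq_neg_of_add_eq_zero_left hcy]; exact Q.neg_mem hy⟩
      rw [hQ.inf_eq_bot] at this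
      exact (smul_eq_zero.1 this).resolve_right hx0)
    (by
      intro z
      have hz : z ∈ Submodule.span K {x} ⊔ Q := by rw [hQ.sup_eq_top]; trivial
      obtain ⟨s, hs, t, ht, rfl⟩ := Submodule.mem_sup.1 hz
      obtain ⟨c, rfl⟩ := Submodule.mem_span_singleton.1 hs
      exact ⟨-c, by rw [neg_smul, add_neg_cancel_comm]; exact ht⟩)
  have hB0 : B 0 = x := by simp [B]
  let w : ℕ → L := fun k => if hk : k < m + 1 then (B ⟨k, hk⟩ : L) else 0
  have hw : ∀ i : Fin (m + 1), w i = B i := fun i => by simp only [w, dif_pos i.2]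
  have hwm : ∀ k, w k ∈ h.compl := by
    intro k
    simp only [w]
    split_ifs
    · exact (B _).2
    · exact h.compl.zero_mem
  let v : ℕ → L
    | 0 => 0
    | 1 => x₁
    | 2 => x₂
    | 3 => x₃
    | 4 => x₄
    | k + 5 => w k
  have hsum : ∀ g : Fin (m + 1 + 4) → K, ∑ i, g i • v (i + 1) =
      g 0 • x₁ + g 1 • x₂ + g 2 • x₃ + g 3 • x₄ +
        ((∑ i : Fin (m + 1), g i.succ.succ.succ.succ • B i : h.compl) : L) := by
    intro g
    rw [Fin.sum_univ_succ, Fin.sum_univ_succ, Fin.sum_univ_succ, Fin.sum_univ_succ]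
    simp only [Submodule.coe_sum, Submodule.coe_smul, ← hw, ← add_assoc]
    rfl
  have hli : LinearIndependent K (fun i : Fin (m + 1 + 4) => v (i + 1)) := by
    rw [Fintype.linearIndependent_iff]
    intro g hg
    rw [hsum] at hg
    obtain ⟨h0, h1, h2, h3, hm⟩ := h.eq_zero_of_add_eq_zero (Subtype.prop _) hg
    have h4 := Fintype.linearIndependent_iff.1 B.linearIndependent _ (Subtype.ext hm)
    intro i
    refine Fin.cases h0 (fun i => ?_) i
    refine Fin.cases h1 (fun i => ?_) i
    refine Fin.cases h2 (fun i => ?_) i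
    exact Fin.cases h3 h4 i
  have hsp : ⊤ ≤ Submodule.span K (Set.range fun i : Fin (m + 1 + 4) => v (i + 1)) := by
    intro y _
    obtain ⟨c₁, c₂, c₃, c₄, z, hz, rfl⟩ := h.exists_eq_add y
    rw [Submodule.mem_span_range_iff_exists_fun]
    refine ⟨Fin.cons c₁ (Fin.cons c₂ (Fin.cons c₃ (Fin.cons c₄ (B.repr ⟨z, hz⟩)))), ?_⟩
    rw [hsum]
    simp only [Fin.cons_succ, B.sum_repr]
    rfl
  let b := Module.Basis.mk hli hsp
  have hmn : n = m + 5 := by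
    rw [← hn, Module.finrank_eq_card_basis b, Fintype.card_fin]
  subst hmn
  refine ⟨v, b, fun i => by simp [b], rfl, rfl, rfl, rfl, ?_, ?_, ?_⟩
  · change w (0 : Fin (m + 1)) = x₅
    rw [hw, hB0]
  · intro k hk
    obtain ⟨k, rfl⟩ := Nat.exists_eq_add_of_le' hk
    exact hwm (k + 1)
  · intro y hy
    have hs := congrArg Subtype.val (B.sum_repr ⟨y, hy⟩)
    rw [Fin.sum_univ_succ, hB0] at hs
    simp only [Submodule.coe_add, Submodule.coe_sum, Submodule.coe_smul, ← hw] at hs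
    refine ⟨B.repr ⟨y, hy⟩ 0,
      -- The shift is by 5 because `v 5` is `B 0`.
      fun k => if hk : k - 5 < m + 1 then B.repr ⟨y, hy⟩ ⟨k - 5, hk⟩ else 0, ?_⟩
    refine hs.symm.trans ?_
    congr 1
    have hI : Finset.Icc 6 (m + 5) = Finset.Ico (0 + 6) (m + 6) := by
      ext k
      simp only [Finset.mem_Icc, Finset.mem_Ico]
      omega
    rw [hI, ← Finset.sum_Ico_add', ← Finset.range_eq_Ico, Finset.sum_range]
    refine Finset.sum_congr rfl fun i _ => ?_
    have hi : (i : ℕ) + 6 - 5 < m + 1 := by omega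
    simp only [dif_pos hi]
    rfl

end IsChain

end Lie

/-! ### Transport of the bracket to coordinates -/

section Transport

variable {K L : Type*} [Field K] [LieRing L] [LieAlgebra K L]

theorem exists_isLieBracket {n : ℕ} (e : L ≃ₗ[K] (Fin n → K)) :
    ∃ μ : (Fin n → K) →ₗ[K] (Fin n → K) →ₗ[K] (Fin n → K),
      IsLieBracket μ ∧ ∀ x y : L, e ⁅x, y⁆ = μ (e x) (e y) := by
  let μ : (Fin n → K) →ₗ[K] (Fin n → K) →ₗ[K] (Fin n → K) :=
    LinearMap.mk₂ K (fun x y => e ⁅e.symm x, e.symm y⁆) (by simp) (by simp) (by simp) (by simp)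
  have hμ : ∀ x y : L, e ⁅x, y⁆ = μ (e x) (e y) := fun x y => by simp [μ]
  refine ⟨μ, ⟨fun x => ?_, fun x y z => ?_⟩, hμ⟩
  · obtain ⟨x, rfl⟩ := e.surjective x
    rw [← hμ, lie_self, map_zero]
  · obtain ⟨x, rfl⟩ := e.surjective x
    obtain ⟨y, rfl⟩ := e.surjective y
    obtain ⟨z, rfl⟩ := e.surjective z
    have h : ⁅⁅x, y⁆, z⁆ + ⁅⁅y, z⁆, x⁆ + ⁅⁅z, x⁆, y⁆ = 0 := by
      have h := lie_jacobi x y z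
      rw [← lie_skew x ⁅y, z⁆, ← lie_skew y ⁅z, x⁆, ← lie_skew z ⁅x, y⁆, ← neg_add,
        ← neg_add, neg_eq_zero] at h
      rw [← h]
      abel
    simp only [← hμ, ← map_add, h, map_zero]

theorem equivFun_eq_X {n : ℕ} {v : ℕ → L} {b : Module.Basis (Fin n) K L}
    (hb : ∀ i, b i = v (i + 1)) {k : ℕ} (hk : 1 ≤ k) (hkn : k ≤ n) : b.equivFun (v k) = X k := by
  obtain ⟨k, rfl⟩ := Nat.exists_eq_add_of_le' hk
  ext i
  rw [← hb ⟨k, hkn⟩, Module.Basis.equivFun_apply, Module.Basis.repr_self]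
  simp only [X, Finsupp.single_eq_pi_single, Pi.single_apply, Fin.ext_iff, Nat.add_right_cancel_iff]

end Transport

/-! ### Bracket table and the two families -/

section Classification

variable {K L : Type*} [Field K] [LieRing L] [LieAlgebra K L]

theorem sum_mul_eq_zero_of_lie_eq_zero {n : ℕ} {v : ℕ → L} {y : L} (hy : y ≠ 0) {a : K}
    {d : ℕ → K} {c : ℕ → ℕ → K} (hc : ∀ i j, 6 ≤ i → 6 ≤ j → ⁅v i, v j⁆ = c i j • y)
    {j : ℕ} (hj : 6 ≤ j) (hjn : j ≤ n) (hyj : ⁅y, v j⁆ = 0)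
    (h : ⁅a • y + ∑ k ∈ Finset.Icc 6 n, d k • v k, v j⁆ = 0) :
    ∑ i ∈ Finset.Ico 6 j, c i j * d i - ∑ i ∈ Finset.Ioc j n, c j i * d i = 0 := by
  have hanti : ∀ i, 6 ≤ i → c i j = -c j i := by
    intro i hi
    have h1 : (c i j + c j i) • y = 0 := by
      rw [add_smul, ← hc i j hi hj, ← hc j i hj hi, ← lie_skew, neg_add_cancel]
    exact eq_neg_of_add_eq_zero_left ((smul_eq_zero.1 h1).resolve_right hy)
  have hjj : c j j = 0 := by
    have h1 := hc j j hj hj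
    rw [lie_self] at h1
    exact (smul_eq_zero.1 h1.symm).resolve_right hy
  have h1 : (∑ k ∈ Finset.Icc 6 n, c k j * d k) • y = 0 := by
    rw [add_lie, smul_lie, hyj, smul_zero, zero_add, sum_lie] at h
    rw [← h, Finset.sum_smul]
    refine Finset.sum_congr rfl fun k hk => ?_
    rw [smul_lie, hc k j (Finset.mem_Icc.1 hk).1 hj, smul_smul, mul_comm]
  have h2 := (smul_eq_zero.1 h1).resolve_right hy
  have hI : Finset.Icc 6 n = Finset.Ico 6 (n + 1) := by
    ext; simp only [Finset.mem_Icc, Finset.mem_Ico]; omega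
  have hJ : Finset.Ioc j n = Finset.Ico (j + 1) (n + 1) := by
    ext; simp only [Finset.mem_Ioc, Finset.mem_Ico]; omega
  rw [hI, ← Finset.sum_Ico_consecutive _ hj (by omega : j ≤ n + 1),
    Finset.sum_eq_sum_Ico_succ_bot (by omega : j < n + 1), hjj, zero_mul, zero_add] at h2
  rw [← h2, hJ, sub_eq_add_neg, ← Finset.sum_neg_distrib]
  congr 1
  refine Finset.sum_congr rfl fun i hi => ?_
  rw [hanti i (by have := (Finset.mem_Ico.1 hi).1; omega), neg_mul]

namespace IsChain

/-- The table of brackets of an adapted basis. -/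
theorem lie_eq_ite [LieRing.IsNilpotent L] {v : ℕ → L}
    (h : IsChain K (v 1) (v 2) (v 3) (v 4) (v 5)) {α β : ℕ → K} {c : ℕ → ℕ → K}
    (h23 : ⁅v 1, ⁅v 2, v 3⁆⁆ = 0) (hv : ∀ k, 6 ≤ k → ⁅v 1, v k⁆ = 0)
    (hαβ : ∀ k, 6 ≤ k → ⁅v 2, v k⁆ = α k • v 4 + β k • v 5 ∧ ⁅v 3, v k⁆ = α k • v 5 ∧
      ⁅v 4, v k⁆ = 0 ∧ ⁅v 5, v k⁆ = 0)
    (hc : ∀ i j, 6 ≤ i → 6 ≤ j → ⁅v i, v j⁆ = c i j • v 5) {i j : ℕ} (hi : 1 ≤ i) (hij : i < j) :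
    ⁅v i, v j⁆ = if i = 1 ∧ j ∈ ({2, 3, 4} : Finset ℕ) then v (j + 1)
      else if i = 2 ∧ j = 3 then ⁅v 2, v 3⁆
      else if i = 2 ∧ 6 ≤ j then α j • v 4 + β j • v 5
      else if i = 3 ∧ 6 ≤ j then α j • v 5
      else if 6 ≤ i then c i j • v 5
      else 0 := by
  obtain ⟨h24, h34⟩ := h.lie_x₄ h23
  obtain ⟨h25, h35, h45⟩ := h.lie_x₅
  rcases lt_or_ge i 6 with hi6 | hi6
  · rcases lt_or_ge j 6 with hj6 | hj6
    · interval_cases i <;> interval_cases j <;>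
        simp [h.lie₂, h.lie₃, h.lie₄, h.lie₅, h24, h34, h25, h35, h45]
    · obtain ⟨h2, h3, h4, h5⟩ := hαβ j hj6
      have hj2 : j ≠ 2 := by omega
      have hj3 : j ≠ 3 := by omega
      have hj4 : j ≠ 4 := by omega
      interval_cases i <;> simp [hv j hj6, h2, h3, h4, h5, hj2, hj3, hj4, hj6]
  · have hi1 : i ≠ 1 := by omega
    have hi2 : i ≠ 2 := by omega
    have hi3 : i ≠ 3 := by omega
    simp [hc i j hi6 (by omega), hi1, hi2, hi3, hi6]

theorem exists_family [LieRing.IsNilpotent L] [FiniteDimensional K L] {x₁ x₂ x₃ x₄ x₅ : L}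
    (h : IsChain K x₁ x₂ x₃ x₄ x₅) {n : ℕ} (hn : 5 ≤ n)
    (hdim : Module.finrank K L = n)
    (hr : Module.finrank K (LinearMap.range (LieAlgebra.ad K L (x₁ + x₂))) ≤ 3)
    (h23 : ⁅x₁, ⁅x₂, x₃⁆⁆ = 0) :
    ∃ μ : (Fin n → K) →ₗ[K] (Fin n → K) →ₗ[K] (Fin n → K),
      (InFirstFamily μ ∨ InSecondFamily μ) ∧
        ∃ e : L ≃ₗ[K] (Fin n → K), ∀ x y : L, e ⁅x, y⁆ = μ (e x) (e y) := by
  obtain ⟨v, b, hb, rfl, rfl, rfl, rfl, rfl, hv, hspan⟩ := h.exists_basis hdim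
  obtain ⟨μ, hμL, hμ⟩ := exists_isLieBracket b.equivFun
  refine ⟨μ, ?_, b.equivFun, hμ⟩
  have hX : ∀ {k}, 1 ≤ k → k ≤ n → b.equivFun (v k) = X k := equivFun_eq_X hb
  have hc : ∀ i j, 6 ≤ i → 6 ≤ j → ∃ c : K, ⁅v i, v j⁆ = c • v 5 := fun i j hi hj =>
    h.exists_lie_compl_compl (hv i hi) (hv j hj)
  choose! c hc using hc
  by_cases hz : ∃ a : K, ⁅v 2, v 3⁆ = a • v 5
  · left
    obtain ⟨a, ha⟩ := hz
    have hαβ : ∀ k, 6 ≤ k → ∃ q r : K, ⁅v 2, v k⁆ = q • v 4 + r • v 5 ∧ ⁅v 3, v k⁆ = q • v 5 ∧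
      ⁅v 4, v k⁆ = 0 ∧ ⁅v 5, v k⁆ = 0 := fun k hk => h.exists_lie_compl (hv k hk)
    choose! α β hαβ using hαβ
    refine ⟨hμL, a, α, β, c, fun i j hi hij hj => ?_⟩
    rw [← hX hi (hij.le.trans hj), ← hX (hi.trans hij.le) hj, ← hμ,
      h.lie_eq_ite h23 (fun k hk => (hv k hk).1) hαβ hc hi hij, ha]
    simp only [firstBracket]
    split_ifs with h1
    · obtain ⟨-, h1⟩ := h1
      simp only [Finset.mem_insert, Finset.mem_singleton] at h1
      exact hX (by omega) (by omega)
    all_goals simp only [map_add, map_smul, map_zero, hX (by decide : 1 ≤ 4) (by omega),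
      hX (by decide : 1 ≤ 5) hn]
  · right
    push Not at hz
    obtain ⟨a, d, hd⟩ := hspan _ (h.lie_mem_compl h23)
    have hβ : ∀ k, 6 ≤ k → ∃ r : K, ⁅v 2, v k⁆ = r • v 5 ∧ ⁅v 3, v k⁆ = 0 ∧
        ⁅v 4, v k⁆ = 0 ∧ ⁅v 5, v k⁆ = 0 := by
      intro k hk
      obtain ⟨r, h2, h3⟩ := h.exists_lie_eq_smul hr h23 hz (hv k hk)
      obtain ⟨-, -, -, -, h4, h5⟩ := h.exists_lie_compl (hv k hk)
      exact ⟨r, h2, h3, h4, h5⟩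
    choose! β hβ using hβ
    refine ⟨hμL, a, β, d, c, fun j hj hjn => ?_, fun i j hi hij hj => ?_⟩
    · refine sum_mul_eq_zero_of_lie_eq_zero h.ne_zero hc hj hjn (hβ j hj).2.2.2 (a := a) ?_
      -- Jacobi: `v j` commutes with `v 3`, and `⁅v 2, v j⁆` is a multiple of `v 5`, which also
      -- does.
      rw [← hd, lie_lie, (hβ j hj).2.1, (hβ j hj).1, lie_smul, h.lie_x₅.2.1,
        lie_zero, smul_zero, sub_zero]
    · have hαβ : ∀ k, 6 ≤ k → ⁅v 2, v k⁆ = (0 : K) • v 4 + β k • v 5 ∧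
          ⁅v 3, v k⁆ = (0 : K) • v 5 ∧ ⁅v 4, v k⁆ = 0 ∧ ⁅v 5, v k⁆ = 0 := by
        simpa only [zero_smul, zero_add] using hβ
      rw [← hX hi (hij.le.trans hj), ← hX (hi.trans hij.le) hj, ← hμ,
        h.lie_eq_ite h23 (fun k hk => (hv k hk).1) hαβ hc hi hij, hd]
      simp only [secondBracket]
      split_ifs with h1 h2 h3 h4 h5 h6
      · obtain ⟨-, h1⟩ := h1
        simp only [Finset.mem_insert, Finset.mem_singleton] at h1
        exact hX (by omega) (by omega)
      · rw [map_add, map_smul, map_sum, hX (by decide) hn]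
        congr 1
        refine Finset.sum_congr rfl fun k hk => ?_
        rw [Finset.mem_Icc] at hk
        rw [map_smul, hX (by omega) hk.2]
      · rw [zero_smul, zero_add, map_smul, hX (by decide) hn]
      -- The second family has no row `i = 3`, so its test `6 ≤ i` gets split inside that row of the
      -- table.
      · omega
      · rw [zero_smul, map_zero]
      · rw [map_smul, hX (by decide) hn]
      · exact map_zero _

end IsChain

end Classification

end NilpotentLie

theorem proposition8 {K : Type*} [Field K] [CharZero K] {L : Type*} [LieRing L] [LieAlgebra K L]
    [FiniteDimensional K L] [LieRing.IsNilpotent L] (n : ℕ) (hn : 5 ≤ n)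
    (hdim : Module.finrank K L = n)
    (hbreadth : NilpotentLie.breadth K L = 3)
    (hchar : NilpotentLie.IsCharacteristicSequence K L (4 :: List.replicate (n - 4) 1)) :
    ∃ μ : (Fin n → K) →ₗ[K] (Fin n → K) →ₗ[K] (Fin n → K),
      (NilpotentLie.InFirstFamily μ ∨ NilpotentLie.InSecondFamily μ) ∧
        ∃ e : L ≃ₗ[K] (Fin n → K), ∀ x y : L, e ⁅x, y⁆ = μ (e x) (e y) := by
  obtain ⟨⟨x, -, hx⟩, -⟩ := hchar
  have : Infinite K := CharZero.infinite K
  have hr : ∀ y : L, Module.finrank K (LinearMap.range (LieAlgebra.ad K L y)) ≤ 3 :=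
    fun y => hbreadth ▸ NilpotentLie.finrank_range_ad_le_breadth K y
  obtain ⟨x₂, x₃, x₄, x₅, h⟩ := NilpotentLie.exists_isChain hr hx
  obtain ⟨x₂', h', h23⟩ := h.exists_lie_lie_eq_zero
  exact h'.exists_family hn hdim (hr _) h23
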